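/- **Setting.** Let $\mathcal X\subset\mathbb R^p$ and $\mathcal W\subset\mathbb R$ be compact, let $x_1,\dots,x_N\in\mathcal X$ and $y_1,\dots,y_N\in\mathbb R$, let $\gamma\ge 0$, let $c:\mathbb R\times\mathbb R\to\mathbb R$ be convex in its first argument, and let $k(x,z;w)$ be a real-valued kernel on $\mathbb{R}^p\times\mathbb{R}^p$ with parameter $w$ (for instance a family of reproducing kernels; positive semidefiniteness is not needed). All integrals are with respect to Lebesgue measure on $\mathcal X\times\mathcal W$, and $\|\alpha\|_{L_0}=\int_{\mathcal X\times\mathcal W}\mathbf 1[\alpha(z,w)\ne 0]\,dz\,dw$. The primal problem is $$\text{(PII)}\qquad \min_{\alpha\in L_2(\mathcal X\times\mathcal W)}\ \tfrac12\|\alpha\|_{L_2}^2+\gamma\|\alpha\|_{L_0}\quad\text{subject to}\quad c(\hat y_i,y_i)\le 0,\quad \hat y_i=\int\alpha(z,w)\,k(x_i,z;w)\,dz\,dw,\quad i=1,\dots,N.$$ With the Lagrangian $$\mathcal L(\alpha,\hat y,\lambda,\mu)=\tfrac12\|\alpha\|_{L_2}^2+\gamma\|\alpha\|_{L_0}-\sum_{i}\lambda_i\int\alpha(z,w)k(x_i,z;w)\,dz\,dw+\sum_i\lambda_i\hat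 y_i+\sum_i\mu_i c(\hat y_i,y_i)$$ and the dual function $g(\lambda,\mu)=\inf_{\alpha\in L_2,\ \hat y\in\mathbb R^N}\mathcal L(\alpha,\hat y,\lambda,\mu)\in[-\infty,\infty)$, the dual problem is $$\text{(DII)}\qquad \max_{\lambda\in\mathbb R^N,\ \mu\in\mathbb R^N_+} g(\lambda,\mu).$$ For $\lambda\in\mathbb R^N$ put $\bar\alpha_d(z,w;\lambda)=\sum_{i=1}^N\lambda_i k(x_i,z;w)$, and let $\alpha_d(z,w;\lambda)=\bar\alpha_d(z,w;\lambda)$ if $|\bar\alpha_d(z,w;\lambda)|>\sqrt{2\gamma}$ and $\alpha_d(z,w;\lambda)=0$ otherwise. **Corollary 1.** Assume that for each $i$ the function $(z,w)\mapsto k(x_i,z;w)$ is in $L_2(\mathcal X\times\mathcal W)$ and real analytic on a neighbourhood of $\mathcal X\times\mathcal W$. Let $(\lambda^\star,\mu^\star)$ be a solution of (DII) and, if $\gamma>0$, assume that $|\bar\alpha_d(\cdot,\cdot;\lambda^\star)|$ is not identically equal to $\sqrt{2\gamma}$ on a neighbourhood (in $\mathbb R^p\times\mathbb R$) of any point of $\mathcal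 X\times\mathcal W$. Then $\alpha_d(\cdot,\cdot;\lambda^\star)$ is a solution of (PII), and every solution of (PII) agrees with it almost everywhere on $\mathcal X\times\mathcal W$. Moreover, if $\gamma>0$, the set $\{(z,w)\in\mathcal X\times\mathcal W:\ |\bar\alpha_d(z,w;\lambda^\star)|=\sqrt{2\gamma}\}$ has Lebesgue measure zero. -/

import Mathlib

open MeasureTheory Filter Topology

noncomputable section

/-- The data of a sparse functional program: a compact set `X ⊆ ℝᵖ` of centers, a compact set
`W ⊆ ℝ` of kernel parameters, a parametrized kernel `k x z w = k(x, z; w)`, training pairs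
`(x i, y i)` with `x i ∈ X`, a loss `c` that is convex in the predicted value, and a
regularization factor `γ ≥ 0`. -/
structure SparseProgram (p N : ℕ) where
  X : Set (EuclideanSpace ℝ (Fin p))
  isCompact_X : IsCompact X
  W : Set ℝ
  isCompact_W : IsCompact W
  k : EuclideanSpace ℝ (Fin p) → EuclideanSpace ℝ (Fin p) → ℝ → ℝ
  x : Fin N → EuclideanSpace ℝ (Fin p)
  x_mem : ∀ i, x i ∈ X
  y : Fin N → ℝ
  c : ℝ → ℝ → ℝ
  convex_c : ∀ t : ℝ, ConvexOn ℝ Set.univ (fun s => c s t)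
  γ : ℝ
  γ_nonneg : 0 ≤ γ

namespace SparseProgram

variable {p N : ℕ} (P : SparseProgram p N)

/-- Lebesgue measure `dz dw` on `X × W`. -/
def leb : Measure (EuclideanSpace ℝ (Fin p) × ℝ) := volume.restrict (P.X ×ˢ P.W)

/-- The section `(z, w) ↦ k(xᵢ, z; w)` of the kernel at the `i`-th data point. -/
def kAt (i : Fin N) (q : EuclideanSpace ℝ (Fin p) × ℝ) : ℝ := P.k (P.x i) q.1 q.2

/-- Membership in `L₂(X × W)`. -/
def InL2 (f : EuclideanSpace ℝ (Fin p) × ℝ → ℝ) : Prop := MemLp f 2 P.leb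

/-- The squared `L₂`-norm on `X × W`. -/
def sqNormL2 (α : EuclideanSpace ℝ (Fin p) × ℝ → ℝ) : ℝ := ∫ q, α q ^ 2 ∂P.leb

/-- The "`L₀`-norm" on `X × W`: the integral of the indicator of `α ≠ 0`. -/
def normL0 (α : EuclideanSpace ℝ (Fin p) × ℝ → ℝ) : ℝ :=
  ∫ q, {q' | α q' ≠ 0}.indicator (fun _ => (1 : ℝ)) q ∂P.leb

/-- The primal objective `½ ‖α‖²_{L₂} + γ ‖α‖_{L₀}`. -/
def objective (α : EuclideanSpace ℝ (Fin p) × ℝ → ℝ) : ℝ :=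
  1 / 2 * P.sqNormL2 α + P.γ * P.normL0 α

/-- The prediction `f(xᵢ) = ∫ α(z, w) k(xᵢ, z; w) dz dw`. -/
def prediction (α : EuclideanSpace ℝ (Fin p) × ℝ → ℝ) (i : Fin N) : ℝ :=
  ∫ q, α q * P.kAt i q ∂P.leb

/-- Feasibility in the primal problem: `α ∈ L₂` and `c(f(xᵢ), yᵢ) ≤ 0` for all `i`. -/
def IsFeasible (α : EuclideanSpace ℝ (Fin p) × ℝ → ℝ) : Prop :=
  P.InL2 α ∧ ∀ i, P.c (P.prediction α i) (P.y i) ≤ 0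

/-- `α` solves the primal problem: it is feasible and minimizes the objective among all
feasible functions. -/
def IsPrimalSolution (α : EuclideanSpace ℝ (Fin p) × ℝ → ℝ) : Prop :=
  P.IsFeasible α ∧ ∀ β, P.IsFeasible β → P.objective α ≤ P.objective β

/-- The Lagrangian `ℒ(α, ŷ, λ, μ)`, with `l = λ`, `m = μ`. -/
def lagrangian (α : EuclideanSpace ℝ (Fin p) × ℝ → ℝ) (yhat l m : Fin N → ℝ) : ℝ :=
  P.objective α - ∑ i, l i * P.prediction α i + ∑ i, l i * yhat i
    + ∑ i, m i * P.c (yhat i) (P.y i)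

/-- The dual function `g(λ, μ)`: the infimum of the Lagrangian over `α ∈ L₂` and `ŷ ∈ ℝᴺ`,
which may be `-∞`. -/
def dualFunction (l m : Fin N → ℝ) : EReal :=
  ⨅ (α : {f : EuclideanSpace ℝ (Fin p) × ℝ → ℝ // P.InL2 f}) (yhat : Fin N → ℝ),
    (P.lagrangian α.1 yhat l m : EReal)

/-- `(λ, μ)` solves the dual problem: `μ ≥ 0` and it maximizes the dual function over
`ℝᴺ × ℝᴺ₊`. -/
def IsDualSolution (l m : Fin N → ℝ) : Prop :=
  (∀ i, 0 ≤ m i) ∧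
    ∀ l' m' : Fin N → ℝ, (∀ i, 0 ≤ m' i) → P.dualFunction l' m' ≤ P.dualFunction l m

/-- The unthresholded function `ᾱ_d(z, w; λ) = ∑ᵢ λᵢ k(xᵢ, z; w)`. -/
def alphaBar (l : Fin N → ℝ) (q : EuclideanSpace ℝ (Fin p) × ℝ) : ℝ := ∑ i, l i * P.kAt i q

open Classical in
/-- The thresholded function `α_d(z, w; λ)`. -/
def alphaD (l : Fin N → ℝ) (q : EuclideanSpace ℝ (Fin p) × ℝ) : ℝ :=
  if √(2 * P.γ) < |P.alphaBar l q| then P.alphaBar l q else 0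

end SparseProgram

end

/-! For fixed `λ` the Lagrangian splits into a part in `α` and a part in `ŷ`. The `α` part is the
integral of a scalar cost, so it is minimized pointwise, by hard thresholding of `ᾱ_d`; the
minimizer is unique away from the ties `|ᾱ_d| = √(2γ)`. When `γ > 0`, analyticity makes the tie set
null (`leb_levelSet_eq_zero`).

No Slater condition is needed, because dual attainment is assumed. Off the ties the predictions of
`α_d` vary continuously with `λ`, which yields a first-order condition at a dual maximizer
(`IsDualSolution.le_sum_prediction`). One family of directions gives feasibility of `α_d`; shrinking
all multipliers gives a zero duality gap. Weak duality then gives optimality, and the unique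
pointwise minimizer gives uniqueness. -/

/-! ### Zero sets of real analytic functions. -/

/-- The zero set of a real analytic function on an open convex set is null, unless the function
vanishes identically there. -/
theorem AnalyticOnNhd.addHaar_inter_zeros_eq_zero {E : Type*} [NormedAddCommGroup E]
    [NormedSpace ℝ E] [FiniteDimensional ℝ E] [MeasurableSpace E] [BorelSpace E]
    (μ : Measure E) [μ.IsAddHaarMeasure] {f : E → ℝ} {V : Set E} (hV : IsOpen V)
    (hVc : Convex ℝ V) (hf : AnalyticOnNhd ℝ f V) {x : E} (hx : x ∈ V) (hfx : f x ≠ 0) :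
    μ (V ∩ {y | f y = 0}) = 0 := by
  set Z := V ∩ {y | f y = 0} with hZ
  have hZm : MeasurableSet Z := by
    have : Z = V \ (V ∩ f ⁻¹' {0}ᶜ) := by
      ext y; simp only [hZ, Set.mem_inter_iff, Set.mem_ofPred_eq, Set.mem_sdiff, Set.mem_preimage,
        Set.mem_compl_iff, Set.mem_singleton_iff]; tauto
    rw [this]
    exact hV.measurableSet.diff
      (hf.continuousOn.isOpen_inter_preimage hV isOpen_compl_singleton).measurableSet
  -- On the line through `x` and `v` the function is analytic in one variable and nonzero at
  -- parameter `0`, so its zeros are discrete in the interval `U`, hence null.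
  have hline : ∀ v : E, ∀ᵐ t : ℝ, AffineMap.homothety x t v ∉ Z := by
    intro v
    let U : Set ℝ := AffineMap.lineMap x v ⁻¹' V
    have hU : IsOpen U := hV.preimage AffineMap.lineMap_continuous
    have hUc : Convex ℝ U := hVc.affine_preimage (AffineMap.lineMap x v)
    have hg : AnalyticOnNhd ℝ (fun t : ℝ => f (AffineMap.lineMap x v t)) U := by
      intro t ht
      have hlin : AnalyticAt ℝ (fun t : ℝ => AffineMap.lineMap x v t) t := by
        have : (fun t : ℝ => AffineMap.lineMap x v t) = fun t : ℝ => t • (v - x) + x := by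
          ext s; simp [AffineMap.lineMap_apply]
        rw [this]
        fun_prop
      exact AnalyticAt.fun_comp (hf _ ht) hlin
    have h0 : (0 : ℝ) ∈ U := by simpa [U] using hx
    rcases hg.eqOn_zero_or_eventually_ne_zero_of_preconnected hUc.isPreconnected with h | h
    · exact absurd (h h0) (by simpa using hfx)
    · have := ae_restrict_le_codiscreteWithin (μ := volume) hU.measurableSet h
      have := (ae_restrict_iff' hU.measurableSet).1 this
      filter_upwards [this] with t ht hZt
      rw [AffineMap.homothety_eq_lineMap] at hZt
      exact ht hZt.1 hZt.2
  have hm : MeasurableSet {q : E × ℝ | AffineMap.homothety x q.2 q.1 ∉ Z} := by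
    have : Measurable fun q : E × ℝ => AffineMap.homothety x q.2 q.1 := by
      simp only [AffineMap.homothety_apply, vsub_eq_sub, vadd_eq_add]
      fun_prop
    exact (this hZm).compl
  -- Fubini turns "for every `v`, almost every ratio" into "for almost every ratio, almost every
  -- `v`". One nonzero ratio suffices, since a homothety only rescales `μ`.
  have h := (Measure.ae_ae_comm (μ := μ) (ν := (volume : Measure ℝ))
    (p := fun v t => AffineMap.homothety x t v ∉ Z) hm).1 (ae_of_all _ hline)
  have hne : ∀ᵐ t : ℝ, t ≠ 0 := Measure.ae_ne volume 0
  obtain ⟨t, ht, ht0⟩ := (h.and hne).exists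
  have hnull : μ (AffineMap.homothety x t ⁻¹' Z) = 0 := by
    rw [ae_iff] at ht
    convert ht using 2
    ext v; simp
  have hsub : Z ⊆ AffineMap.homothety x t '' (AffineMap.homothety x t ⁻¹' Z) := by
    intro z hz
    have : AffineMap.homothety x t (AffineMap.homothety x t⁻¹ z) = z := by
      simp [AffineMap.homothety_apply, smul_smul, ht0]
    exact ⟨AffineMap.homothety x t⁻¹ z, by simpa [this] using hz, this⟩
  refine measure_mono_null hsub ?_
  rw [Measure.addHaar_image_homothety, hnull, mul_zero]

theorem AnalyticAt.exists_mem_nhds_addHaar_zeros_eq_zero {E : Type*} [NormedAddCommGroup E]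
    [NormedSpace ℝ E] [FiniteDimensional ℝ E] [MeasurableSpace E] [BorelSpace E]
    (μ : Measure E) [μ.IsAddHaarMeasure] {f : E → ℝ} {q : E} (hf : AnalyticAt ℝ f q)
    (hq : ∃ᶠ y in 𝓝 q, f y ≠ 0) : ∃ u ∈ 𝓝 q, μ (u ∩ {y | f y = 0}) = 0 := by
  obtain ⟨r, hr, hball⟩ := Metric.eventually_nhds_iff_ball.1 hf.eventually_analyticAt
  obtain ⟨x, hx, hfx⟩ := (hq.and_eventually (Metric.ball_mem_nhds q hr)).exists
  exact ⟨_, Metric.ball_mem_nhds q hr, AnalyticOnNhd.addHaar_inter_zeros_eq_zero μ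
    Metric.isOpen_ball (convex_ball q r) hball hfx hx⟩

/-! ### Subgradients of convex functions. -/

/-- A convex function on the real line has an affine support function at every point. -/
theorem ConvexOn.exists_subgradient {f : ℝ → ℝ} (hf : ConvexOn ℝ Set.univ f) (x : ℝ) :
    ∃ ξ : ℝ, ∀ y, f x + ξ * (y - x) ≤ f y := by
  have hx : x ∈ interior (Set.univ : Set ℝ) := by simp
  -- The right derivative also serves to the left of `x`, because it dominates the left derivative.
  refine ⟨derivWithin f (Set.Ioi x) x, fun y => ?_⟩
  rcases lt_trichotomy x y with h | rfl | h
  · have := hf.le_slope_of_hasDerivWithinAt_Ioi (Set.mem_univ x) (Set.mem_univ y) h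
      (hf.hasDerivWithinAt_rightDeriv_of_mem_interior hx)
    rw [slope_def_field, le_div_iff₀ (sub_pos.2 h)] at this
    linarith
  · simp
  · have := (hf.slope_le_of_hasDerivWithinAt_Iio (Set.mem_univ y) (Set.mem_univ x) h
      (hf.hasDerivWithinAt_leftDeriv_of_mem_interior hx)).trans
      (hf.leftDeriv_le_rightDeriv_of_mem_interior hx)
    rw [slope_def_field, div_le_iff₀ (sub_pos.2 h)] at this
    linarith

/-! ### The scalar problem and hard thresholding. -/

open Classical in
/-- The hard thresholding operator at level `√(2γ)`. -/
noncomputable def hardThreshold (γ t : ℝ) : ℝ := if √(2 * γ) < |t| then t else 0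

open Classical in
/-- The integrand `½ s² + γ 1[s ≠ 0] - s t` of the Lagrangian. -/
noncomputable def sparseCost (γ s t : ℝ) : ℝ := 1 / 2 * s ^ 2 + γ * (if s ≠ 0 then 1 else 0) - s * t

theorem abs_hardThreshold_le (γ t : ℝ) : |hardThreshold γ t| ≤ |t| := by
  unfold hardThreshold
  split_ifs <;> simp

theorem hardThreshold_zero (t : ℝ) : hardThreshold 0 t = t := by
  unfold hardThreshold
  split_ifs with h
  · rfl
  · simp only [mul_zero, Real.sqrt_zero, abs_pos, not_not] at h
    exact h.symm

theorem measurable_hardThreshold (γ : ℝ) : Measurable (hardThreshold γ) :=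
  Measurable.ite (measurableSet_lt measurable_const measurable_norm) measurable_id measurable_const

/-- The only jumps are at `|t| = √(2γ)`, and for `γ = 0` there are none: the operator is the
identity. Hence ties matter only for positive `γ`. -/
theorem continuousAt_hardThreshold {γ t : ℝ} (h : 0 < γ → |t| ≠ √(2 * γ)) (hγ : 0 ≤ γ) :
    ContinuousAt (hardThreshold γ) t := by
  rcases hγ.eq_or_lt with rfl | hpos
  · rw [show hardThreshold 0 = id from funext hardThreshold_zero]
    exact continuousAt_id
  rcases lt_or_gt_of_ne (h hpos) with hlt | hlt
  · have : hardThreshold γ =ᶠ[𝓝 t] fun _ => 0 := by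
      filter_upwards [continuous_abs.continuousAt.eventually_lt_const hlt] with s hs
      exact if_neg hs.not_gt
    exact continuousAt_const.congr this.symm
  · have : hardThreshold γ =ᶠ[𝓝 t] id := by
      filter_upwards [continuous_abs.continuousAt.eventually_const_lt hlt] with s hs
      exact if_pos hs
    exact continuousAt_id.congr this.symm

/-- With no sign condition on `γ`, the clause `t ≠ 0` covers negative `γ`, where the square root
takes the value `0`. -/
theorem sqrt_lt_abs_iff {γ t : ℝ} : √(2 * γ) < |t| ↔ t ≠ 0 ∧ 2 * γ < t ^ 2 := by
  rw [← sq_abs t, ← abs_pos]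
  constructor
  · intro h
    have h0 := (Real.sqrt_nonneg _).trans_lt h
    exact ⟨h0, (Real.sqrt_lt' h0).1 h⟩
  · rintro ⟨h0, h⟩
    exact (Real.sqrt_lt' h0).2 h

/-- The cost is `0` at `s = 0` and `½(s - t)² + γ - ½t²` elsewhere, so the candidates are `0` and
`t`, and the comparison of `t²` with `2γ` decides. -/
theorem sparseCost_hardThreshold_le {γ : ℝ} (hγ : 0 ≤ γ) (s t : ℝ) :
    sparseCost γ (hardThreshold γ t) t ≤ sparseCost γ s t := by
  unfold hardThreshold sparseCost
  by_cases h : √(2 * γ) < |t|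
  · obtain ⟨h0, h1⟩ := sqrt_lt_abs_iff.1 h
    by_cases hs : s = 0
    · simp only [h, h0, hs, if_true, ne_eq, not_false_eq_true, not_true_eq_false, if_false]
      nlinarith
    · simp only [h, h0, hs, if_true, ne_eq, not_false_eq_true]
      nlinarith [sq_nonneg (s - t)]
  · have h1 : t ^ 2 ≤ 2 * γ := by
      by_contra! h1
      exact h (sqrt_lt_abs_iff.2 ⟨by rintro rfl; nlinarith, h1⟩)
    by_cases hs : s = 0
    · simp only [h, hs, if_false, le_refl]
    · simp only [h, hs, if_true, ne_eq, not_false_eq_true, not_true_eq_false, if_false]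
      nlinarith [sq_nonneg (s - t)]

/-- For `γ > 0` the two candidates tie exactly when `t² = 2γ`, which is excluded; for `γ = 0` the
cost is strictly convex. -/
theorem eq_hardThreshold_of_sparseCost_le {γ s t : ℝ} (hγ : 0 ≤ γ) (ht : 0 < γ → |t| ≠ √(2 * γ))
    (hle : sparseCost γ s t ≤ sparseCost γ (hardThreshold γ t) t) : s = hardThreshold γ t := by
  unfold hardThreshold sparseCost at *
  by_cases h : √(2 * γ) < |t|
  · obtain ⟨h0, h1⟩ := sqrt_lt_abs_iff.1 h
    by_cases hs : s = 0
    · simp only [h, h0, hs, if_true, ne_eq, not_false_eq_true, not_true_eq_false, if_false] at hle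
      nlinarith
    · simp only [h, h0, hs, if_true, ne_eq, not_false_eq_true] at hle ⊢
      have : (s - t) ^ 2 ≤ 0 := by nlinarith
      exact sub_eq_zero.1 (pow_eq_zero_iff two_ne_zero |>.1 (le_antisymm this (sq_nonneg _)))
  · simp only [h, if_false] at hle ⊢
    by_contra hs
    simp only [hs, if_true, ne_eq, not_false_eq_true, not_true_eq_false, if_false] at hle
    rcases hγ.eq_or_lt with rfl | hpos
    · have h0 : t = 0 := by simpa using h
      subst h0
      have : 0 < s ^ 2 := by positivity
      linarith
    · have hlt := lt_of_le_of_ne (not_lt.1 h) (ht hpos)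
      rw [Real.lt_sqrt (abs_nonneg t), sq_abs] at hlt
      nlinarith [sq_nonneg (s - t)]

/-! ### Minimization over `α` and continuity of the predictions. -/

namespace SparseProgram

variable {p N : ℕ} (P : SparseProgram p N)

theorem isCompact_domain : IsCompact (P.X ×ˢ P.W) := P.isCompact_X.prod P.isCompact_W

instance isFiniteMeasure_leb : IsFiniteMeasure P.leb :=
  ⟨by rw [leb, Measure.restrict_apply_univ]; exact P.isCompact_domain.measure_lt_top⟩

theorem alphaD_eq (l : Fin N → ℝ) (q : EuclideanSpace ℝ (Fin p) × ℝ) :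
    P.alphaD l q = hardThreshold P.γ (P.alphaBar l q) := rfl

theorem leb_levelSet_eq_zero (han : ∀ i, AnalyticOnNhd ℝ (P.kAt i) (P.X ×ˢ P.W)) (l : Fin N → ℝ)
    (hnd : ∀ q ∈ P.X ×ˢ P.W, ∃ᶠ q' in 𝓝 q, |P.alphaBar l q'| ≠ √(2 * P.γ)) :
    P.leb {q | |P.alphaBar l q| = √(2 * P.γ)} = 0 := by
  -- Squaring replaces the absolute value by an analytic expression.
  have hz : ∀ q, |P.alphaBar l q| = √(2 * P.γ) ↔ P.alphaBar l q ^ 2 - √(2 * P.γ) ^ 2 = 0 := by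
    intro q
    rw [sub_eq_zero, ← sq_abs (P.alphaBar l q), sq_eq_sq₀ (abs_nonneg _) (Real.sqrt_nonneg _)]
  have hmeas : MeasurableSet (P.X ×ˢ P.W) := P.isCompact_domain.measurableSet
  rw [leb, Measure.restrict_apply' hmeas]
  refine measure_null_of_locally_null _ fun q hq => ?_
  have hana : AnalyticAt ℝ (fun q => P.alphaBar l q ^ 2 - √(2 * P.γ) ^ 2) q := by
    have : AnalyticAt ℝ (P.alphaBar l) q := by
      have h : AnalyticAt ℝ (fun q => ∑ i, l i * P.kAt i q) q :=
        Finset.analyticAt_fun_sum _ fun i _ => analyticAt_const.mul (han i q hq.2)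
      exact h
    exact (this.pow 2).sub analyticAt_const
  have : (volume : Measure (EuclideanSpace ℝ (Fin p) × ℝ)).IsAddHaarMeasure := by
    rw [Measure.volume_eq_prod]
    infer_instance
  obtain ⟨u, hu, hu0⟩ := hana.exists_mem_nhds_addHaar_zeros_eq_zero volume
    ((hnd q hq.2).mono fun y hy h => hy ((hz y).2 h))
  refine ⟨_, ?_, hu0⟩
  filter_upwards [mem_nhdsWithin_of_mem_nhds hu, self_mem_nhdsWithin] with y hy hys
  exact ⟨hy, (hz y).1 hys.1⟩

variable {P}

theorem InL2.integrable_mul {f g : EuclideanSpace ℝ (Fin p) × ℝ → ℝ} (hf : P.InL2 f)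
    (hg : P.InL2 g) : Integrable (fun q => f q * g q) P.leb :=
  MemLp.integrable_mul hf hg

theorem inL2_alphaBar (hL2 : ∀ i, P.InL2 (P.kAt i)) (l : Fin N → ℝ) : P.InL2 (P.alphaBar l) :=
  memLp_finsetSum _ fun i _ => (hL2 i).const_mul (l i)

theorem inL2_alphaD (hL2 : ∀ i, P.InL2 (P.kAt i)) (l : Fin N → ℝ) : P.InL2 (P.alphaD l) := by
  have h := inL2_alphaBar hL2 l
  refine MemLp.mono h ?_ (ae_of_all _ fun q => abs_hardThreshold_le _ _)
  exact ((measurable_hardThreshold P.γ).comp_aemeasurable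
    h.aestronglyMeasurable.aemeasurable).aestronglyMeasurable

theorem InL2.integrable_support {α : EuclideanSpace ℝ (Fin p) × ℝ → ℝ} (hα : P.InL2 α) :
    Integrable ({q' | α q' ≠ 0}.indicator fun _ => (1 : ℝ)) P.leb := by
  refine (integrable_const (1 : ℝ)).indicator₀ ?_
  exact hα.aestronglyMeasurable.aemeasurable.nullMeasurableSet_preimage
    (measurableSet_singleton (0 : ℝ)).compl

theorem sparseCost_alphaBar_eq {α : EuclideanSpace ℝ (Fin p) × ℝ → ℝ} (l : Fin N → ℝ) :
    (fun q => sparseCost P.γ (α q) (P.alphaBar l q)) = fun q =>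
      (1 / 2 * α q ^ 2 + P.γ * {q' | α q' ≠ 0}.indicator (fun _ => (1 : ℝ)) q)
        - α q * P.alphaBar l q := by
  classical
  ext q
  simp [sparseCost, Set.indicator_apply]

theorem InL2.integrable_sparseCost (hL2 : ∀ i, P.InL2 (P.kAt i)) (l : Fin N → ℝ)
    {α : EuclideanSpace ℝ (Fin p) × ℝ → ℝ} (hα : P.InL2 α) :
    Integrable (fun q => sparseCost P.γ (α q) (P.alphaBar l q)) P.leb := by
  rw [sparseCost_alphaBar_eq]
  exact ((hα.integrable_sq.const_mul _).add (hα.integrable_support.const_mul _)).sub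
    (hα.integrable_mul (inL2_alphaBar hL2 l))

/-- This decouples the minimization over `α` into the scalar problem at each point. -/
theorem InL2.integral_sparseCost (hL2 : ∀ i, P.InL2 (P.kAt i)) (l : Fin N → ℝ)
    {α : EuclideanSpace ℝ (Fin p) × ℝ → ℝ} (hα : P.InL2 α) :
    ∫ q, sparseCost P.γ (α q) (P.alphaBar l q) ∂P.leb
      = P.objective α - ∑ i, l i * P.prediction α i := by
  have hsum : ∫ q, α q * P.alphaBar l q ∂P.leb = ∑ i, l i * P.prediction α i := by
    simp only [alphaBar, Finset.mul_sum, prediction, ← integral_const_mul]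
    rw [integral_finsetSum]
    · exact Finset.sum_congr rfl fun i _ => integral_congr_ae (ae_of_all _ fun q => by ring)
    · intro i _
      exact hα.integrable_mul ((hL2 i).const_mul (l i))
  rw [sparseCost_alphaBar_eq, integral_sub _ (hα.integrable_mul (inL2_alphaBar hL2 l)), integral_add
    (hα.integrable_sq.const_mul _) (hα.integrable_support.const_mul _), integral_const_mul,
    integral_const_mul, hsum]
  · rfl
  · exact (hα.integrable_sq.const_mul _).add (hα.integrable_support.const_mul _)

/-- `α_d(·; λ)` minimizes the part of the Lagrangian that depends on `α`. -/
theorem InL2.alphaD_minimizes (hL2 : ∀ i, P.InL2 (P.kAt i)) (l : Fin N → ℝ)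
    {α : EuclideanSpace ℝ (Fin p) × ℝ → ℝ} (hα : P.InL2 α) :
    P.objective (P.alphaD l) - ∑ i, l i * P.prediction (P.alphaD l) i
      ≤ P.objective α - ∑ i, l i * P.prediction α i := by
  have hd := inL2_alphaD hL2 l
  rw [← hd.integral_sparseCost hL2, ← hα.integral_sparseCost hL2]
  exact integral_mono (hd.integrable_sparseCost hL2 l) (hα.integrable_sparseCost hL2 l)
    fun q => sparseCost_hardThreshold_le P.γ_nonneg _ _

/-- Integrands ordered pointwise with equal integrals agree almost everywhere, so scalar uniqueness
applies at almost every point. -/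
theorem InL2.ae_eq_alphaD_of_le (hL2 : ∀ i, P.InL2 (P.kAt i)) (l : Fin N → ℝ)
    (hlev : ∀ᵐ q ∂P.leb, 0 < P.γ → |P.alphaBar l q| ≠ √(2 * P.γ))
    {α : EuclideanSpace ℝ (Fin p) × ℝ → ℝ} (hα : P.InL2 α)
    (hle : P.objective α - ∑ i, l i * P.prediction α i
      ≤ P.objective (P.alphaD l) - ∑ i, l i * P.prediction (P.alphaD l) i) :
    α =ᵐ[P.leb] P.alphaD l := by
  have hd := inL2_alphaD hL2 l
  rw [← hd.integral_sparseCost hL2, ← hα.integral_sparseCost hL2] at hle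
  have hmono : (fun q => sparseCost P.γ (P.alphaD l q) (P.alphaBar l q))
      ≤ᵐ[P.leb] fun q => sparseCost P.γ (α q) (P.alphaBar l q) :=
    ae_of_all _ fun q => sparseCost_hardThreshold_le P.γ_nonneg _ _
  have hid := hd.integrable_sparseCost hL2 l
  have hia := hα.integrable_sparseCost hL2 l
  have heq := (integral_eq_iff_of_ae_le hid hia hmono).1
    (le_antisymm (integral_mono_ae hid hia hmono) hle)
  filter_upwards [heq, hlev] with q hq hl
  exact eq_hardThreshold_of_sparseCost_le P.γ_nonneg hl hq.ge

/-- The predictions of `α_d(·; λ)` depend continuously on `λ` along lines. -/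
theorem tendsto_prediction_alphaD (hL2 : ∀ i, P.InL2 (P.kAt i)) (l d : Fin N → ℝ)
    (hlev : ∀ᵐ q ∂P.leb, 0 < P.γ → |P.alphaBar l q| ≠ √(2 * P.γ)) (i : Fin N) :
    Tendsto (fun ε : ℝ => P.prediction (P.alphaD (l + ε • d)) i) (𝓝[>] 0)
      (𝓝 (P.prediction (P.alphaD l) i)) := by
  have hlin : ∀ (ε : ℝ) q, P.alphaBar (l + ε • d) q = P.alphaBar l q + ε * P.alphaBar d q := by
    intro ε q
    simp only [alphaBar, Pi.add_apply, Pi.smul_apply, smul_eq_mul, Finset.mul_sum,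
      ← Finset.sum_add_distrib]
    exact Finset.sum_congr rfl fun j _ => by ring
  have hbar := fun l => inL2_alphaBar hL2 l
  -- Thresholding does not increase absolute values, which gives the bound for `0 < ε < 1`; almost
  -- every point is a continuity point of the threshold.
  refine tendsto_integral_filter_of_dominated_convergence
    (fun q => (|P.alphaBar l q| + |P.alphaBar d q|) * |P.kAt i q|) ?_ ?_ ?_ ?_
  · exact Eventually.of_forall fun ε =>
      ((inL2_alphaD hL2 _).integrable_mul (hL2 i)).aestronglyMeasurable
  · filter_upwards [Ioo_mem_nhdsGT one_pos] with ε hε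
    refine ae_of_all _ fun q => ?_
    rw [Real.norm_eq_abs, abs_mul]
    refine mul_le_mul_of_nonneg_right ?_ (abs_nonneg _)
    refine (abs_hardThreshold_le _ _).trans ?_
    rw [hlin]
    refine (abs_add_le _ _).trans (add_le_add le_rfl ?_)
    rw [abs_mul, abs_of_pos hε.1]
    exact mul_le_of_le_one_left (abs_nonneg _) hε.2.le
  · exact InL2.integrable_mul (P := P) ((hbar l).abs.add (hbar d).abs) (hL2 i).abs
  · filter_upwards [hlev] with q hq
    refine Tendsto.mul_const _ ?_
    have hc := continuousAt_hardThreshold hq P.γ_nonneg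
    have ht : Tendsto (fun ε : ℝ => P.alphaBar (l + ε • d) q) (𝓝[>] 0) (𝓝 (P.alphaBar l q)) := by
      simp only [hlin]
      have : Continuous fun ε : ℝ => P.alphaBar l q + ε * P.alphaBar d q := by fun_prop
      simpa using (this.tendsto 0).mono_left nhdsWithin_le_nhds
    exact hc.tendsto.comp ht

end SparseProgram

/-! ### Duality and first-order optimality. -/

namespace SparseProgram

variable {p N : ℕ} {P : SparseProgram p N}

theorem dualFunction_le {α : EuclideanSpace ℝ (Fin p) × ℝ → ℝ} (hα : P.InL2 α)
    (yhat l m : Fin N → ℝ) : P.dualFunction l m ≤ (P.lagrangian α yhat l m : EReal) :=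
  iInf₂_le (f := fun (α : {f : EuclideanSpace ℝ (Fin p) × ℝ → ℝ // P.InL2 f})
    (yhat : Fin N → ℝ) => (P.lagrangian α.1 yhat l m : EReal)) ⟨α, hα⟩ yhat

/-- The two parts of the Lagrangian are bounded separately; a real lower bound `B` avoids handling a
possibly infinite infimum over `ŷ`. -/
theorem le_dualFunction (hL2 : ∀ i, P.InL2 (P.kAt i)) {l m : Fin N → ℝ} {B : ℝ}
    (hB : ∀ yhat : Fin N → ℝ, B ≤ ∑ i, l i * yhat i + ∑ i, m i * P.c (yhat i) (P.y i)) :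
    ((P.objective (P.alphaD l) - ∑ i, l i * P.prediction (P.alphaD l) i + B : ℝ) : EReal)
      ≤ P.dualFunction l m := by
  refine le_iInf₂ fun α yhat => EReal.coe_le_coe_iff.2 ?_
  have h := α.2.alphaD_minimizes hL2 l
  have := hB yhat
  unfold lagrangian
  linarith

theorem objective_nonneg (α : EuclideanSpace ℝ (Fin p) × ℝ → ℝ) : 0 ≤ P.objective α := by
  have h1 : 0 ≤ P.sqNormL2 α := integral_nonneg fun q => sq_nonneg _
  have h2 : 0 ≤ P.normL0 α :=
    integral_nonneg fun q => Set.indicator_nonneg (fun _ _ => zero_le_one) q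
  have := P.γ_nonneg
  unfold objective
  positivity

/-- The value of the dual problem is finite as soon as it is attained. -/
theorem IsDualSolution.exists_dualFunction_eq {l m : Fin N → ℝ} (h : P.IsDualSolution l m) :
    ∃ T : ℝ, P.dualFunction l m = (T : EReal) := by
  -- At zero multipliers the Lagrangian is the nonnegative objective, so the maximal dual value is
  -- not `-∞`.
  have h0 : (0 : EReal) ≤ P.dualFunction 0 0 := by
    refine le_iInf₂ fun α yhat => EReal.coe_nonneg.2 ?_
    simpa [lagrangian] using objective_nonneg α.1
  have h1 := h0.trans (h.2 0 0 fun _ => le_rfl)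
  have h2 := dualFunction_le (P := P) (α := 0) MemLp.zero 0 l m
  exact ⟨_, (EReal.coe_toReal (ne_top_of_le_ne_top (EReal.coe_ne_top _) h2)
    (ne_bot_of_le_ne_bot EReal.zero_ne_bot h1)).symm⟩

/-- Weak duality. -/
theorem dualFunction_le_objective {α : EuclideanSpace ℝ (Fin p) × ℝ → ℝ} (hα : P.IsFeasible α)
    {l m : Fin N → ℝ} (hm : ∀ i, 0 ≤ m i) : P.dualFunction l m ≤ (P.objective α : EReal) := by
  refine (dualFunction_le hα.1 (P.prediction α) l m).trans (EReal.coe_le_coe_iff.2 ?_)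
  have : ∑ i, m i * P.c (P.prediction α i) (P.y i) ≤ 0 :=
    Finset.sum_nonpos fun i _ => mul_nonpos_of_nonneg_of_nonpos (hm i) (hα.2 i)
  unfold lagrangian
  linarith

/-- First-order optimality of a dual solution along a direction `(d, e)`, where `B` is a lower
bound on the part of the Lagrangian that depends on `ŷ` along that direction. -/
theorem IsDualSolution.le_sum_prediction (hL2 : ∀ i, P.InL2 (P.kAt i)) {l m : Fin N → ℝ}
    (h : P.IsDualSolution l m)
    (hlev : ∀ᵐ q ∂P.leb, 0 < P.γ → |P.alphaBar l q| ≠ √(2 * P.γ)) {T : ℝ}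
    (hT : P.dualFunction l m = (T : EReal)) (d e : Fin N → ℝ) (B : ℝ)
    (he : ∀ᶠ ε : ℝ in 𝓝[>] 0, ∀ i, 0 ≤ m i + ε * e i)
    (hB : ∀ᶠ ε : ℝ in 𝓝[>] 0, ∀ yhat : Fin N → ℝ,
      T - (P.objective (P.alphaD l) - ∑ i, l i * P.prediction (P.alphaD l) i) + ε * B
        ≤ ∑ i, (l i + ε * d i) * yhat i + ∑ i, (m i + ε * e i) * P.c (yhat i) (P.y i)) :
    B ≤ ∑ i, d i * P.prediction (P.alphaD l) i := by
  have htend : Tendsto (fun ε : ℝ => ∑ i, d i * P.prediction (P.alphaD (l + ε • d)) i) (𝓝[>] 0)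
      (𝓝 (∑ i, d i * P.prediction (P.alphaD l) i)) :=
    tendsto_finsetSum _ fun i _ => (tendsto_prediction_alphaD hL2 l d hlev i).const_mul (d i)
  refine ge_of_tendsto htend ?_
  filter_upwards [he, hB, self_mem_nhdsWithin] with ε he hB (hε : 0 < ε)
  have h1 := (le_dualFunction hL2 (l := l + ε • d) (m := m + ε • e) hB).trans (h.2 _ _ he)
  rw [hT, EReal.coe_le_coe_iff] at h1
  -- Envelope argument: the minimizer for `l + ε • d` is a competitor for `l`. Combined with `h1`
  -- this bounds `ε * B` by `ε` times the directional predictions at `l + ε • d`; the limit then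
  -- moves them to `l`.
  have h2 := (inL2_alphaD hL2 (l + ε • d)).alphaD_minimizes hL2 l
  have h3 : ∑ i, (l + ε • d) i * P.prediction (P.alphaD (l + ε • d)) i
      = ∑ i, l i * P.prediction (P.alphaD (l + ε • d)) i
        + ε * ∑ i, d i * P.prediction (P.alphaD (l + ε • d)) i := by
    simp only [Finset.mul_sum, ← Finset.sum_add_distrib, Pi.add_apply, Pi.smul_apply, smul_eq_mul]
    exact Finset.sum_congr rfl fun i _ => by ring
  rw [h3] at h1
  refine le_of_mul_le_mul_left ?_ hε
  linarith

theorem sub_le_of_dualFunction_eq {l m : Fin N → ℝ} (hL2 : ∀ i, P.InL2 (P.kAt i)) {T : ℝ}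
    (hT : P.dualFunction l m = (T : EReal)) (yhat : Fin N → ℝ) :
    T - (P.objective (P.alphaD l) - ∑ i, l i * P.prediction (P.alphaD l) i)
      ≤ ∑ i, l i * yhat i + ∑ i, m i * P.c (yhat i) (P.y i) := by
  have := dualFunction_le (inL2_alphaD hL2 l) yhat l m
  rw [hT, EReal.coe_le_coe_iff, lagrangian] at this
  linarith

theorem IsDualSolution.isFeasible_alphaD (hL2 : ∀ i, P.InL2 (P.kAt i)) {l m : Fin N → ℝ}
    (h : P.IsDualSolution l m)
    (hlev : ∀ᵐ q ∂P.leb, 0 < P.γ → |P.alphaBar l q| ≠ √(2 * P.γ)) :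
    P.IsFeasible (P.alphaD l) := by
  obtain ⟨T, hT⟩ := h.exists_dualFunction_eq
  refine ⟨inL2_alphaD hL2 l, fun i => ?_⟩
  set s := P.prediction (P.alphaD l) i with hs
  obtain ⟨ξ, hξ⟩ := (P.convex_c (P.y i)).exists_subgradient s
  -- Raising `m i` by `ε` and lowering `l i` by `ε * ξ` adds `ε * (c(ŷᵢ) - ξ * ŷᵢ)`, which the
  -- subgradient inequality bounds below by its value at `s`. The first-order condition becomes
  -- `c(s) - ξ * s ≤ -ξ * s`.
  have key := h.le_sum_prediction hL2 hlev hT (Pi.single i (-ξ)) (Pi.single i 1)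
    (P.c s (P.y i) - ξ * s) ?_ ?_
  · simp only [Pi.single_apply, ite_mul, zero_mul, Finset.sum_ite_eq', Finset.mem_univ,
      if_true, ← hs] at key
    linarith
  · filter_upwards [self_mem_nhdsWithin] with ε (hε : 0 < ε) j
    have : (0 : ℝ) ≤ (Pi.single i 1 : Fin N → ℝ) j := by
      rw [Pi.single_apply]; split_ifs <;> norm_num
    have := h.1 j
    positivity
  · filter_upwards [self_mem_nhdsWithin] with ε (hε : 0 < ε) yhat
    have h1 := sub_le_of_dualFunction_eq hL2 hT yhat
    have h2 : ε * (P.c s (P.y i) - ξ * s) ≤ ε * (-ξ * yhat i + P.c (yhat i) (P.y i)) :=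
      mul_le_mul_of_nonneg_left (by linarith [hξ (yhat i)]) hε.le
    simp only [add_mul, Finset.sum_add_distrib, Pi.single_apply, mul_ite, ite_mul, zero_mul,
      mul_zero, Finset.sum_ite_eq', Finset.mem_univ, if_true]
    linarith

/-- Strong duality: a dual solution closes the duality gap. -/
theorem IsDualSolution.objective_alphaD_le (hL2 : ∀ i, P.InL2 (P.kAt i)) {l m : Fin N → ℝ}
    (h : P.IsDualSolution l m)
    (hlev : ∀ᵐ q ∂P.leb, 0 < P.γ → |P.alphaBar l q| ≠ √(2 * P.γ)) {T : ℝ}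
    (hT : P.dualFunction l m = (T : EReal)) : P.objective (P.alphaD l) ≤ T := by
  -- This direction scales the multipliers, hence the whole `ŷ` part and its lower bound, by `1 -
  -- ε`. In the resulting inequality the terms `∑ i, l i * P.prediction (P.alphaD l) i` cancel.
  have key := h.le_sum_prediction hL2 hlev hT (-l) (-m)
    (-(T - (P.objective (P.alphaD l) - ∑ i, l i * P.prediction (P.alphaD l) i))) ?_ ?_
  · simp only [Pi.neg_apply, neg_mul, Finset.sum_neg_distrib] at key
    linarith
  · filter_upwards [Ioo_mem_nhdsGT one_pos] with ε hε i
    have := mul_nonneg (sub_nonneg.2 hε.2.le) (h.1 i)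
    simp only [Pi.neg_apply]
    linarith
  · filter_upwards [Ioo_mem_nhdsGT one_pos] with ε hε yhat
    have h1 := mul_le_mul_of_nonneg_left (sub_le_of_dualFunction_eq hL2 hT yhat)
      (sub_nonneg.2 hε.2.le)
    have h2 : ∑ i, (l i + ε * (-l) i) * yhat i = (1 - ε) * ∑ i, l i * yhat i := by
      rw [Finset.mul_sum]
      exact Finset.sum_congr rfl fun i _ => by simp only [Pi.neg_apply]; ring
    have h3 : ∑ i, (m i + ε * (-m) i) * P.c (yhat i) (P.y i)
        = (1 - ε) * ∑ i, m i * P.c (yhat i) (P.y i) := by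
      rw [Finset.mul_sum]
      exact Finset.sum_congr rfl fun i _ => by simp only [Pi.neg_apply]; ring
    rw [h2, h3]
    linarith

end SparseProgram

/-! ### The corollary. -/

/-- `hnd` says that, for `γ > 0`, the analytic function `ᾱ_d² - 2γ` does not vanish identically
near any point of `X × W`; without it the claim fails already for a constant kernel. -/
theorem corollary1 {p N : ℕ} (P : SparseProgram p N)
    (hL2 : ∀ i, P.InL2 (P.kAt i))
    (han : ∀ i, AnalyticOnNhd ℝ (P.kAt i) (P.X ×ˢ P.W))
    (lstar mstar : Fin N → ℝ) (hdual : P.IsDualSolution lstar mstar)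
    (hnd : 0 < P.γ → ∀ q ∈ P.X ×ˢ P.W, ∃ᶠ q' in 𝓝 q, |P.alphaBar lstar q'| ≠ √(2 * P.γ)) :
    P.IsPrimalSolution (P.alphaD lstar) ∧
    (∀ α, P.IsPrimalSolution α → α =ᵐ[P.leb] P.alphaD lstar) ∧
    (0 < P.γ → P.leb {q | |P.alphaBar lstar q| = √(2 * P.γ)} = 0) := by
  have hnull : 0 < P.γ → P.leb {q | |P.alphaBar lstar q| = √(2 * P.γ)} = 0 :=
    fun hγ => P.leb_levelSet_eq_zero han lstar (hnd hγ)
  have hlev : ∀ᵐ q ∂P.leb, 0 < P.γ → |P.alphaBar lstar q| ≠ √(2 * P.γ) := by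
    by_cases hγ : 0 < P.γ
    · filter_upwards [measure_eq_zero_iff_ae_notMem.1 (hnull hγ)] with q hq _ h
      exact hq h
    · exact ae_of_all _ fun q h => absurd h hγ
  obtain ⟨T, hT⟩ := hdual.exists_dualFunction_eq
  have hfeas := hdual.isFeasible_alphaD hL2 hlev
  have hobj := hdual.objective_alphaD_le hL2 hlev hT
  refine ⟨⟨hfeas, fun β hβ => hobj.trans ?_⟩, fun α hα => ?_, hnull⟩
  · have := SparseProgram.dualFunction_le_objective hβ (l := lstar) hdual.1
    rwa [hT, EReal.coe_le_coe_iff] at this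
  -- A primal solution also minimizes the `α` part at `lstar`: its objective is at most `T`, and
  -- testing the dual value with `ŷ` equal to its own predictions gives the required bound.
  · refine hα.1.1.ae_eq_alphaD_of_le hL2 lstar hlev ?_
    have h1 := SparseProgram.sub_le_of_dualFunction_eq hL2 hT (P.prediction α)
    have h2 : ∑ i, mstar i * P.c (P.prediction α i) (P.y i) ≤ 0 :=
      Finset.sum_nonpos fun i _ => mul_nonpos_of_nonneg_of_nonpos (hdual.1 i) (hα.1.2 i)
    have h3 := hα.2 _ hfeas
    linarith
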